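/- A hypergraph is a finite set of vertices, a finite set of edges and a finite set of hinges, where each hinge attaches one edge to one vertex and every edge has at least one hinge; the degree of a vertex is the number of hinges at it, and an edge joins a set $U$ of vertices if it has exactly one hinge at each vertex of $U$ and no other hinges. Let $n,p,k,m$ be positive integers, let $R=[r_1\dots r_k]^T$ and $\Lambda=[\lambda_1\dots\lambda_m]^T$ be vectors of positive integers, and let $H=[h_1\dots h_m]^T$ have pairwise distinct integer entries with $2\le h_j\le n$. Let $\Lambda K^H_{n\times p}$ be the hypergraph whose vertex set is partitioned into $n$ parts of $p$ vertices each, in which, for $1\le j\le m$, every set of $h_j$ vertices containing at most one vertex from each part is joined by exactly $\lambda_j$ edges, and which has no other edges. A hypergraph is almost $R$-factorizable if its edge set can be decomposed into $k$ pairwise disjoint (possibly empty) classes $F_1,\dots,F_k$ such that, for $1\le i\le k$, every vertex has degree $r_i-1$ or $r_i$ in the spanning sub-hypergraph with edge set $F_i$. Write $s(X)$ for the sum of all entries of a matrix $X$, $A_j$ for the $j$-th column of $A$, $J_k$ for the all-ones column vector of length $k$, and $\le$ between vectors for the entrywise order. **Theorem.** $\Lambda K^H_{n\times p}$ is almost $R$-factorizable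 if and only if $$s(R)-k\;\le\;\sum_{j=1}^m \lambda_j\binom{n-1}{h_j-1}p^{h_j-1}\;\le\; s(R),$$ and there exists a $k\times m$ matrix $A=[a_{ij}]$ of non-negative integers such that $$np(R-J_k)\le AH\le npR\qquad\text{and}\qquad s(A_j)=\lambda_j\binom{n}{h_j}p^{h_j}\quad\text{for } 1\le j\le m.$$ -/

import Mathlib

/-- A hypergraph with vertex set `V`, edge set `E` and set of hinges `T` (finiteness of the three
types is assumed where it is used). Each hinge `t` attaches the edge `φ t` to the vertex `ψ t`,
and every edge has at least one hinge. -/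
structure HingeHypergraph (V E T : Type*) where
  ψ : T → V
  φ : T → E
  φ_surjective : Function.Surjective φ

namespace HingeHypergraph

variable {V E T : Type*}

/-- The degree of a vertex: the number of hinges incident with it. -/
noncomputable def degree (G : HingeHypergraph V E T) (v : V) : ℕ :=
  {t : T | G.ψ t = v}.ncard

/-- The set `H(v, e)` of hinges incident with both the vertex `v` and the edge `e`. -/
def hinges (G : HingeHypergraph V E T) (v : V) (e : E) : Set T :=
  {t : T | G.ψ t = v ∧ G.φ t = e}

open Classical in
/-- For a multiset `U` of vertices, the set `E(U)` of the edges that join precisely the vertices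
in `U`, each with its multiplicity. -/
def edgesJoining (G : HingeHypergraph V E T) (U : Multiset V) : Set E :=
  {e : E | ∀ v : V, (G.hinges v e).ncard = U.count v}

/-- The multiplicity `m(U) = |E(U)|`. -/
noncomputable def multiplicity (G : HingeHypergraph V E T) (U : Multiset V) : ℕ :=
  (G.edgesJoining U).ncard

/-- The spanning sub-hypergraph with edge set `F`: all vertices, the edges in `F`, and all hinges
incident with an edge in `F`. -/
def spanningSub (G : HingeHypergraph V E T) (F : Set E) :
    HingeHypergraph V F {t : T // G.φ t ∈ F} where
  ψ t := G.ψ t.1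
  φ t := ⟨G.φ t.1, t.2⟩
  φ_surjective := by
    rintro ⟨e, he⟩
    obtain ⟨t, rfl⟩ := G.φ_surjective e
    exact ⟨⟨t, he⟩, rfl⟩

/-- The spanning sub-hypergraph with edge set `F` is a `(q, r)`-factor: all its degrees lie
between `q` and `r`. -/
def IsFactor (G : HingeHypergraph V E T) (q r : ℤ) (F : Set E) : Prop :=
  ∀ v : V, q ≤ ((G.spanningSub F).degree v : ℤ) ∧ ((G.spanningSub F).degree v : ℤ) ≤ r

/-- `G` has a `(Q, R)`-factorization: a decomposition of the edge set into `F 0, …, F (k - 1)`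
such that `F i` is a `(Q i, R i)`-factor. (As usual for decompositions given by the colour classes
of an edge-colouring, some `F i` may be empty; this can only happen if `Q i ≤ 0`.) -/
def IsFactorizable (G : HingeHypergraph V E T) {k : ℕ} (Q R : Fin k → ℤ) : Prop :=
  ∃ F : Fin k → Set E,
    (Pairwise fun i j => Disjoint (F i) (F j)) ∧ (⋃ i, F i) = Set.univ ∧
      ∀ i, G.IsFactor (Q i) (R i) (F i)

/-- An almost `R`-factorization is an `(R - J, R)`-factorization, `J` being the all-ones vector. -/
def IsAlmostFactorizable (G : HingeHypergraph V E T) {k : ℕ} (R : Fin k → ℤ) : Prop :=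
  G.IsFactorizable (fun i => R i - 1) R

/-- `G` is the hypergraph `Λ K_{n × p}^H`: its vertices are partitioned into `n` parts of `p`
vertices each (`part v` is the part of `v`), every set of `H j` vertices with at most one vertex
from each part is joined by exactly `Λ j` edges, and there are no other edges. -/
def IsCompleteMultipartite (G : HingeHypergraph V E T) (n p : ℕ) {m : ℕ} (Λ H : Fin m → ℕ) :
    Prop :=
  ∃ part : V → Fin n,
    (∀ i, {v : V | part v = i}.ncard = p) ∧
    (∀ (j : Fin m) (U : Finset V), U.card = H j → Set.InjOn part (U : Set V) →
      G.multiplicity U.val = Λ j) ∧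
    (∀ e : E, ∃ (j : Fin m) (U : Finset V), U.card = H j ∧ Set.InjOn part (U : Set V) ∧
      e ∈ G.edgesJoining U.val)

end HingeHypergraph

/-! Necessity is double counting: if `A i j` is the number of edges of size `H j` in the class `i`,
summing degrees over the `n * p` vertices bounds the rows, and counting transversals gives the
column sums. Summing the row bounds then gives the inequalities on the common degree, so the first
condition follows from the second.

For sufficiency, take `A i j` abstract edges of colour `i` and size `H j`, and choose their vertices
one vertex at a time. The type of an edge records its size and the choices made so far. With `N + 1`
vertices left, an edge that still needs `s` of them gets weight `s / (N + 1)`: this is a fractional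
choice of the edges through the next vertex, with exactly the right total on every type and the
average degree on every colour. Types and colours are two partitions of the edges, and integral
bounds on the fibre sums of two partitions define an integral polytope, so the choice can be rounded
(`exists_subset_rounding`, `exists_fair_choice`).

Iterating gives `exists_fair_subsets`. It is applied with the parts as points, then inside each part
(`exists_fair_block_subsets`). The outcome uses every transversal as often as the given hypergraph
does, so the two agree up to renaming edges. -/

/-! ### Rounding with respect to two partitions -/

/-- A family of points of `[0, 1]` with integral sum contains no or at least two fractional ones. -/
theorem two_le_card_fractional {Y : Type*} (B : Finset Y) (w : Y → ℝ)
    (hw : ∀ y, 0 ≤ w y ∧ w y ≤ 1) (z : ℤ) (hz : ∑ y ∈ B, w y = z) (y₀ : Y) (hy₀ : y₀ ∈ B)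
    (h₀ : 0 < w y₀ ∧ w y₀ < 1) : 2 ≤ (B.filter fun y => 0 < w y ∧ w y < 1).card := by
  classical
  by_contra hlt
  have hmem : y₀ ∈ B.filter fun y => 0 < w y ∧ w y < 1 := by simp [hy₀, h₀]
  have hcard : (B.filter fun y => 0 < w y ∧ w y < 1).card = 1 := by
    have := Finset.card_pos.2 ⟨y₀, hmem⟩
    omega
  have hone : ∀ y ∈ B.erase y₀, w y = ((if w y = 1 then 1 else 0 : ℤ) : ℝ) := by
    intro y hy
    obtain ⟨hne, hyB⟩ := Finset.mem_erase.1 hy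
    have hnot : ¬ (0 < w y ∧ w y < 1) := fun hf =>
      hne (Finset.card_le_one.1 hcard.le y (by simp [hyB, hf]) y₀ hmem)
    split_ifs with h1
    · simpa using h1
    · have := hw y
      have h2 : w y < 1 := lt_of_le_of_ne this.2 h1
      have h3 : ¬ 0 < w y := fun h => hnot ⟨h, h2⟩
      simp only [Int.cast_zero]
      linarith
  rw [← Finset.add_sum_erase _ _ hy₀, Finset.sum_congr rfl hone, ← Int.cast_sum] at hz
  set s : ℤ := ∑ y ∈ B.erase y₀, if w y = 1 then 1 else 0
  have h1 : (0 : ℝ) < ((z - s : ℤ) : ℝ) := by push_cast; linarith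
  have h2 : ((z - s : ℤ) : ℝ) < ((1 : ℤ) : ℝ) := by push_cast; linarith
  have h3 : 0 < z - s := by exact_mod_cast h1
  have h4 : z - s < 1 := by exact_mod_cast h2
  omega

/-- Dimension count: there are fewer linear conditions than free coordinates. -/
theorem exists_ne_zero_sum_fiber_eq_zero {Y J K : Type*} [Fintype Y] [DecidableEq J]
    [DecidableEq K] (τ : Y → J) (c : Y → K) (F : Finset Y) (S : Finset J) (T : Finset K)
    (h : S.card + T.card < F.card) :
    ∃ d : Y → ℝ, d ≠ 0 ∧ (∀ y ∉ F, d y = 0) ∧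
      (∀ j ∈ S, ∑ y with τ y = j, d y = 0) ∧ ∀ i ∈ T, ∑ y with c y = i, d y = 0 := by
  classical
  let ext : (F → ℝ) →ₗ[ℝ] (Y → ℝ) :=
    { toFun := fun x y => if hy : y ∈ F then x ⟨y, hy⟩ else 0
      map_add' := by intro a b; ext y; by_cases hy : y ∈ F <;> simp [hy]
      map_smul' := by intro a b; ext y; by_cases hy : y ∈ F <;> simp [hy] }
  let Φ : (F → ℝ) →ₗ[ℝ] (S → ℝ) × (T → ℝ) :=
    { toFun := fun x => (fun j => ∑ y with τ y = j.1, ext x y,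
        fun i => ∑ y with c y = i.1, ext x y)
      map_add' := by
        intro a b
        ext <;> simp [Finset.sum_add_distrib]
      map_smul' := by
        intro a b
        ext <;> simp [Finset.mul_sum] }
  have hker : LinearMap.ker Φ ≠ ⊥ := by
    apply LinearMap.ker_ne_bot_of_finrank_lt
    simpa using h
  obtain ⟨x, hx, hx0⟩ := (Submodule.ne_bot_iff _).1 hker
  have hΦ : Φ x = 0 := hx
  refine ⟨ext x, ?_, ?_, ?_, ?_⟩
  · intro h0
    apply hx0
    ext y
    have := congrFun h0 y.1
    simpa [ext] using this
  · intro y hy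
    simp [ext, hy]
  · intro j hj
    exact congrFun (congrArg Prod.fst hΦ) ⟨j, hj⟩
  · intro i hi
    exact congrFun (congrArg Prod.snd hΦ) ⟨i, hi⟩

theorem two_mul_card_integral_fibers_le {Y J : Type*} [Fintype Y] [DecidableEq J]
    (τ : Y → J) (w : Y → ℝ) (hw : ∀ y, 0 ≤ w y ∧ w y ≤ 1) (F : Finset Y)
    (hF : ∀ y, y ∈ F ↔ 0 < w y ∧ w y < 1) (S : Finset J)
    (hS : ∀ j ∈ S, (∃ y ∈ F, τ y = j) ∧ ∃ z : ℤ, ∑ y with τ y = j, w y = z) :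
    2 * S.card ≤ (F.filter fun y => τ y ∈ S).card := by
  classical
  rw [Finset.card_eq_sum_card_fiberwise (f := τ) (t := S) (fun y hy => by
    simpa using (Finset.mem_filter.1 hy).2), mul_comm, ← smul_eq_mul]
  refine Finset.card_nsmul_le_sum _ _ _ fun j hj => ?_
  obtain ⟨⟨y₀, hy₀, hτ⟩, z, hz⟩ := hS j hj
  refine (two_le_card_fractional _ w hw z hz y₀ (by simp [hτ]) ((hF y₀).1 hy₀)).trans ?_
  refine Finset.card_le_card fun y hy => ?_
  simp only [Finset.mem_filter, Finset.mem_univ, true_and] at hy ⊢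
  exact ⟨⟨(hF y).2 hy.2, hy.1 ▸ hj⟩, hy.1⟩

theorem sum_fiber_eq_zero {Y ι : Type*} [Fintype Y] [DecidableEq ι] (σ : Y → ι)
    (F : Finset Y) (d : Y → ℝ) (hd : ∀ y ∉ F, d y = 0) (j : ι) (hj : j ∉ F.image σ) :
    ∑ y with σ y = j, d y = 0 := by
  refine Finset.sum_eq_zero fun y hy => hd y fun hyF => hj ?_
  rw [← (Finset.mem_filter.1 hy).2]
  exact Finset.mem_image_of_mem _ hyF

theorem sum_sum_fiber_eq {Y ι : Type*} [Fintype Y] [DecidableEq ι] (σ : Y → ι)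
    (F : Finset Y) (d : Y → ℝ) (hd : ∀ y ∉ F, d y = 0) (X : Finset ι)
    (hX : ∀ y ∈ F, σ y ∈ X) : ∑ j ∈ X, ∑ y with σ y = j, d y = ∑ y, d y := by
  classical
  have h1 : ∀ B : Finset Y, ∑ y ∈ B, d y = ∑ y ∈ B with y ∈ F, d y := by
    intro B
    rw [Finset.sum_filter]
    refine Finset.sum_congr rfl fun y _ => ?_
    split_ifs with h
    · rfl
    · exact hd y h
  rw [h1 Finset.univ, ← Finset.sum_fiberwise_of_maps_to (t := X) (g := σ)
    (fun y hy => hX y (Finset.mem_filter.1 hy).2)]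
  refine Finset.sum_congr rfl fun j _ => ?_
  rw [h1, Finset.filter_filter, Finset.filter_filter]
  simp only [and_comm]

/-- If `w : Y → [0, 1]` is not integral, it can be perturbed without changing its values in
`{0, 1}` and its integral fibre sums, for any two partitions of `Y`. -/
theorem exists_perturbation {Y J K : Type*} [Fintype Y] [DecidableEq J] [DecidableEq K]
    (τ : Y → J) (c : Y → K) (w : Y → ℝ) (hw : ∀ y, 0 ≤ w y ∧ w y ≤ 1) (y₀ : Y)
    (hy₀ : 0 < w y₀ ∧ w y₀ < 1) :
    ∃ d : Y → ℝ, d ≠ 0 ∧ (∀ y, ¬ (0 < w y ∧ w y < 1) → d y = 0) ∧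
      (∀ j, (∃ z : ℤ, ∑ y with τ y = j, w y = z) → ∑ y with τ y = j, d y = 0) ∧
      ∀ i, (∃ z : ℤ, ∑ y with c y = i, w y = z) → ∑ y with c y = i, d y = 0 := by
  classical
  set F : Finset Y := Finset.univ.filter fun y => 0 < w y ∧ w y < 1 with hFdef
  have hF : ∀ y, y ∈ F ↔ 0 < w y ∧ w y < 1 := by simp [hFdef]
  set S := (F.image τ).filter fun j => ∃ z : ℤ, ∑ y with τ y = j, w y = z with hSdef
  set T := (F.image c).filter fun i => ∃ z : ℤ, ∑ y with c y = i, w y = z with hTdef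
  have hS := two_mul_card_integral_fibers_le τ w hw F hF S (by simp [hSdef])
  have hT := two_mul_card_integral_fibers_le c w hw F hF T (by simp [hTdef])
  have hSle := Finset.card_filter_le F fun y => τ y ∈ S
  have hTle := Finset.card_filter_le F fun y => c y ∈ T
  have hFpos : 0 < F.card := Finset.card_pos.2 ⟨y₀, (hF y₀).2 hy₀⟩
  have key : ∃ d : Y → ℝ, d ≠ 0 ∧ (∀ y ∉ F, d y = 0) ∧
      (∀ j ∈ S, ∑ y with τ y = j, d y = 0) ∧ ∀ i ∈ T, ∑ y with c y = i, d y = 0 := by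
    by_cases hall : S.card + T.card < F.card
    · exact exists_ne_zero_sum_fiber_eq_zero τ c F S T hall
    -- Now `S.card + T.card = F.card`, so equality holds throughout: every fractional point lies in
    -- an integral fibre of both partitions.
    have hSF : (F.filter fun y => τ y ∈ S) = F :=
      Finset.eq_of_subset_of_card_le (Finset.filter_subset _ _) (by omega)
    have hTF : (F.filter fun y => c y ∈ T) = F :=
      Finset.eq_of_subset_of_card_le (Finset.filter_subset _ _) (by omega)
    have hj₀ : τ y₀ ∈ S := (Finset.filter_eq_self.1 hSF) y₀ ((hF y₀).2 hy₀)
    have hcard := Finset.card_erase_of_mem hj₀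
    have hSpos := Finset.card_pos.2 ⟨_, hj₀⟩
    obtain ⟨d, hd0, hdF, hdS, hdT⟩ :=
      -- One condition is redundant: the fibre sums over `S` and over `T` both add up to the total
      -- of `d`, so the one dropped at `τ y₀` is recovered from the others.
      exists_ne_zero_sum_fiber_eq_zero τ c F (S.erase (τ y₀)) T (by omega)
    refine ⟨d, hd0, hdF, fun j hj => ?_, hdT⟩
    by_cases hjj : j = τ y₀
    swap
    · exact hdS j (Finset.mem_erase.2 ⟨hjj, hj⟩)
    have e1 := sum_sum_fiber_eq τ F d hdF S (Finset.filter_eq_self.1 hSF)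
    have e2 := sum_sum_fiber_eq c F d hdF T (Finset.filter_eq_self.1 hTF)
    rw [Finset.sum_eq_zero hdT] at e2
    rw [← e2, ← Finset.add_sum_erase _ _ hj₀, Finset.sum_eq_zero hdS, add_zero] at e1
    rw [hjj, e1]
  obtain ⟨d, hd0, hdF, hdS, hdT⟩ := key
  refine ⟨d, hd0, fun y hy => hdF y fun h => hy ((hF y).1 h), fun j hj => ?_, fun i hi => ?_⟩
  · by_cases h : j ∈ F.image τ
    · exact hdS j (Finset.mem_filter.2 ⟨h, hj⟩)
    · exact sum_fiber_eq_zero τ F d hdF j h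
  · by_cases h : i ∈ F.image c
    · exact hdT i (Finset.mem_filter.2 ⟨h, hi⟩)
    · exact sum_fiber_eq_zero c F d hdF i h

open Filter Topology in
/-- A fractional subset of `Y` whose fibre sums, for two partitions of `Y`, obey integral bounds
can be rounded to a subset whose fibre sums obey the same bounds. -/
theorem exists_subset_rounding {Y J K : Type*} [Fintype Y] [Finite J] [Finite K] [DecidableEq J]
    [DecidableEq K] (τ : Y → J) (c : Y → K) (lo hi : J → ℤ) (lo' hi' : K → ℤ) (w : Y → ℝ)
    (hw : ∀ y, 0 ≤ w y ∧ w y ≤ 1)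
    (hτ : ∀ j, (lo j : ℝ) ≤ ∑ y with τ y = j, w y ∧ ∑ y with τ y = j, w y ≤ hi j)
    (hc : ∀ i, (lo' i : ℝ) ≤ ∑ y with c y = i, w y ∧ ∑ y with c y = i, w y ≤ hi' i) :
    ∃ Z : Finset Y,
      (∀ j, lo j ≤ (Z.filter fun y => τ y = j).card ∧
        ((Z.filter fun y => τ y = j).card : ℤ) ≤ hi j) ∧
      ∀ i, lo' i ≤ (Z.filter fun y => c y = i).card ∧
        ((Z.filter fun y => c y = i).card : ℤ) ≤ hi' i := by
  classical
  let P : Set (Y → ℝ) := {x | (∀ y, 0 ≤ x y ∧ x y ≤ 1) ∧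
    (∀ j, (lo j : ℝ) ≤ ∑ y with τ y = j, x y ∧ ∑ y with τ y = j, x y ≤ hi j) ∧
    ∀ i, (lo' i : ℝ) ≤ ∑ y with c y = i, x y ∧ ∑ y with c y = i, x y ≤ hi' i}
  have hPclosed : IsClosed P := by
    simp only [P, Set.ofPred_and, Set.ofPred_forall]
    refine IsClosed.inter ?_ (IsClosed.inter ?_ ?_) <;>
      refine isClosed_iInter fun _ => IsClosed.inter ?_ ?_ <;>
      exact isClosed_le (by fun_prop) (by fun_prop)
  have hPcompact : IsCompact P := by
    refine (isCompact_Icc (a := (0 : Y → ℝ)) (b := 1)).of_isClosed_subset hPclosed ?_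
    intro x hx
    exact ⟨fun y => (hx.1 y).1, fun y => (hx.1 y).2⟩
  obtain ⟨x, hxP, hxe⟩ := hPcompact.extremePoints_nonempty ⟨w, hw, hτ, hc⟩
  have hint : ∀ y, x y = if x y = 1 then 1 else 0 := by
    intro y
    by_contra hy
    have hfrac : 0 < x y ∧ x y < 1 := by
      have := hxP.1 y
      split_ifs at hy with h
      · exact absurd h hy
      · exact ⟨lt_of_le_of_ne this.1 (Ne.symm hy), lt_of_le_of_ne this.2 h⟩
    obtain ⟨d, hd0, hdF, hdτ, hdc⟩ := exists_perturbation τ c x hxP.1 y hfrac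
    -- An integral sum is unchanged by `d`; a non-integral one lies strictly between its integral
    -- bounds and tolerates a small change.
    have hbetween : ∀ (B : Finset Y) (l u : ℤ), ((l : ℝ) ≤ ∑ y ∈ B, x y ∧ ∑ y ∈ B, x y ≤ u) →
        ((∃ z : ℤ, ∑ y ∈ B, x y = z) → ∑ y ∈ B, d y = 0) →
        ∀ᶠ ε in 𝓝 (0 : ℝ), (l : ℝ) ≤ ∑ y ∈ B, (x + ε • d) y ∧ ∑ y ∈ B, (x + ε • d) y ≤ u := by
      intro B l u hB hBd
      have hsum : ∀ ε : ℝ, ∑ y ∈ B, (x + ε • d) y = ∑ y ∈ B, x y + ε * ∑ y ∈ B, d y := by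
        intro ε
        simp [Finset.sum_add_distrib, Finset.mul_sum]
      simp only [hsum]
      by_cases hz : ∃ z : ℤ, ∑ y ∈ B, x y = z
      · simp only [hBd hz, mul_zero, add_zero]
        exact Eventually.of_forall fun _ => hB
      · have hl : (l : ℝ) < ∑ y ∈ B, x y := lt_of_le_of_ne hB.1 fun h => hz ⟨l, h.symm⟩
        have hu : ∑ y ∈ B, x y < (u : ℝ) := lt_of_le_of_ne hB.2 fun h => hz ⟨u, h⟩
        have hcont : Tendsto (fun ε : ℝ => ∑ y ∈ B, x y + ε * ∑ y ∈ B, d y) (𝓝 0)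
            (𝓝 (∑ y ∈ B, x y)) := by
          have : Continuous fun ε : ℝ => ∑ y ∈ B, x y + ε * ∑ y ∈ B, d y := by fun_prop
          simpa using this.tendsto 0
        filter_upwards [hcont.eventually_const_lt hl, hcont.eventually_lt_const hu] with ε h1 h2
        exact ⟨h1.le, h2.le⟩
    have hev : ∀ᶠ ε in 𝓝 (0 : ℝ), x + ε • d ∈ P := by
      refine Eventually.and ?_ (Eventually.and ?_ ?_) <;> refine eventually_all.2 fun a => ?_
      · have := hbetween {a} 0 1 (by simpa using hxP.1 a) (by
          rintro ⟨z, hz⟩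
          rw [Finset.sum_singleton] at hz ⊢
          refine hdF a fun h => ?_
          rw [hz] at h
          have h1 : 0 < z := by exact_mod_cast h.1
          have h2 : z < 1 := by exact_mod_cast h.2
          omega)
        simpa using this
      · exact hbetween _ _ _ (hxP.2.1 a) (hdτ a)
      · exact hbetween _ _ _ (hxP.2.2 a) (hdc a)
    obtain ⟨δ, hδ, hball⟩ := Metric.eventually_nhds_iff.1 hev
    have hp : x + (δ / 2) • d ∈ P := hball (by simp [abs_of_pos hδ]; linarith)
    have hm : x + (-(δ / 2)) • d ∈ P := hball (by simp [abs_of_pos hδ]; linarith)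
    -- `x` would be the midpoint of two points of `P`, hence equal to both by extremality.
    have := hxe hp hm ⟨1 / 2, 1 / 2, by norm_num, by norm_num, by norm_num, by
      ext y; simp; ring⟩
    refine hd0 ?_
    have h0 : (δ / 2) • d = 0 := by simpa using this
    exact (smul_eq_zero.1 h0).resolve_left (by positivity)
  have hcount : ∀ B : Finset Y,
      ∑ y ∈ B, x y = (((Finset.univ.filter fun y => x y = 1) ∩ B).card : ℤ) := by
    intro B
    rw [Finset.sum_congr rfl fun y _ => hint y, ← Finset.sum_filter]
    simp [Finset.filter_inter]
  refine ⟨Finset.univ.filter fun y => x y = 1, fun j => ?_, fun i => ?_⟩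
  · have := hxP.2.1 j
    rw [hcount, Finset.inter_filter, Finset.inter_univ] at this
    exact_mod_cast this
  · have := hxP.2.2 i
    rw [hcount, Finset.inter_filter, Finset.inter_univ] at this
    exact_mod_cast this

/-! ### Fair distribution of coloured edges, vertex by vertex -/

/-- Choice of the edges through one of `N + 1` vertices: the share of every type is prescribed and
the colours are treated evenly. -/
theorem exists_fair_choice {Y J K : Type*} [Fintype Y] [Finite J] [Finite K] [DecidableEq J]
    [DecidableEq K] (τ : Y → J) (c : Y → K) (L U : K → ℕ) (N : ℕ) (s μ : J → ℕ)
    (hτ : ∀ j, (Finset.univ.filter fun y => τ y = j).card = μ j * (N + 1).choose (s j))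
    (hc : ∀ i, (N + 1) * L i ≤ ∑ y with c y = i, s (τ y) ∧
      ∑ y with c y = i, s (τ y) ≤ (N + 1) * U i) :
    ∃ Z : Finset Y,
      (∀ j, (Z.filter fun y => τ y = j).card =
        if s j = 0 then 0 else μ j * N.choose (s j - 1)) ∧
      ∀ i, (L i ≤ (Z.filter fun y => c y = i).card ∧ (Z.filter fun y => c y = i).card ≤ U i) ∧
        N * L i + (Z.filter fun y => c y = i).card ≤ ∑ y with c y = i, s (τ y) ∧
        ∑ y with c y = i, s (τ y) ≤ N * U i + (Z.filter fun y => c y = i).card := by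
  classical
  have hs : ∀ y, s (τ y) ≤ N + 1 := by
    intro y
    by_contra h
    have h1 := hτ (τ y)
    rw [Nat.choose_eq_zero_of_lt (by omega), mul_zero, Finset.card_eq_zero] at h1
    exact Finset.notMem_empty y (h1 ▸ by simp)
  have hN : (0 : ℝ) < (N : ℝ) + 1 := by positivity
  let D : K → ℕ := fun i => ∑ y with c y = i, s (τ y)
  have hD : ∀ i, ∑ y with c y = i, ((s (τ y) : ℝ) / (N + 1)) = (D i : ℝ) / (N + 1) := by
    intro i
    rw [← Finset.sum_div, ← Nat.cast_sum]
  obtain ⟨Z, hZ, hZ'⟩ := exists_subset_rounding τ c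
    -- Equal bounds make the type counts exact; the colour counts are confined to the floor and the
    -- ceiling of the average `D i / (N + 1)`.
    (fun j => ((if s j = 0 then 0 else μ j * N.choose (s j - 1) : ℕ) : ℤ))
    (fun j => ((if s j = 0 then 0 else μ j * N.choose (s j - 1) : ℕ) : ℤ))
    (fun i => ((D i / (N + 1) : ℕ) : ℤ)) (fun i => (((D i + N) / (N + 1) : ℕ) : ℤ))
    (fun y => (s (τ y) : ℝ) / (N + 1))
    (fun y => ⟨by positivity, by
      rw [div_le_one hN]
      exact_mod_cast hs y⟩)
    (by
      intro j
      have hsum : ∑ y with τ y = j, ((s (τ y) : ℝ) / (N + 1)) =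
          ((if s j = 0 then 0 else μ j * N.choose (s j - 1) : ℕ) : ℝ) := by
        rw [Finset.sum_congr rfl (g := fun _ => (s j : ℝ) / (N + 1)) (fun y hy => by
          rw [(Finset.mem_filter.1 hy).2]), Finset.sum_const, hτ, nsmul_eq_mul]
        split_ifs with h
        · simp [h]
        · obtain ⟨t, ht⟩ := Nat.exists_eq_succ_of_ne_zero h
          have := Nat.add_one_mul_choose_eq N t
          have h2 : ((N : ℝ) + 1) * (N.choose t : ℝ) =
              ((N + 1).choose (t + 1) : ℝ) * ((t : ℝ) + 1) := by exact_mod_cast this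
          rw [ht]
          simp only [Nat.succ_eq_add_one, Nat.add_sub_cancel]
          push_cast
          field_simp
          linear_combination (-(μ j : ℝ)) * h2
      rw [hsum]
      exact ⟨by simp, by simp⟩)
    (by
      intro i
      rw [hD]
      constructor
      · rw [le_div_iff₀ hN]
        exact_mod_cast Nat.div_mul_le_self (D i) (N + 1)
      · rw [div_le_iff₀ hN]
        have h1 := Nat.div_add_mod (D i + N) (N + 1)
        have h2 := Nat.mod_lt (D i + N) (Nat.succ_pos N)
        have h3 : D i ≤ (D i + N) / (N + 1) * (N + 1) := by
          rw [mul_comm]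
          simp only [Nat.succ_eq_add_one] at h2
          omega
        exact_mod_cast h3)
  refine ⟨Z, fun j => ?_, fun i => ?_⟩
  · have := hZ j
    omega
  · obtain ⟨h1, h2⟩ := hZ' i
    norm_cast at h1 h2
    obtain ⟨hL, hU⟩ := hc i
    change _ ≤ D i at hL
    change D i ≤ _ at hU
    change _ ∧ _ ≤ D i ∧ D i ≤ _
    generalize (Z.filter fun y => c y = i).card = z at *
    refine ⟨⟨?_, ?_⟩, ?_, ?_⟩
    · refine le_trans ?_ h1
      rw [Nat.le_div_iff_mul_le (Nat.succ_pos N)]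
      nlinarith
    · refine h2.trans ?_
      rw [Nat.div_le_iff_le_mul_add_pred (Nat.succ_pos N)]
      simp only [Nat.succ_eq_add_one, Nat.add_sub_cancel]
      nlinarith
    -- With `D i = N * L i + x` and `L i ≤ x`, the average is at most `x`, hence so is its ceiling.
    -- The upper bound is dual, using the floor.
    · obtain ⟨x, hx⟩ := Nat.exists_eq_add_of_le (show N * L i ≤ D i by nlinarith)
      have : z ≤ x := by
        refine h2.trans ?_
        rw [Nat.div_le_iff_le_mul_add_pred (Nat.succ_pos N)]
        simp only [Nat.succ_eq_add_one, Nat.add_sub_cancel]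
        have hLx : L i ≤ x := by nlinarith
        nlinarith [Nat.mul_le_mul_left N hLx]
      omega
    · by_cases hle : D i ≤ N * U i
      · omega
      obtain ⟨x, hx⟩ := Nat.exists_eq_add_of_le (le_of_not_ge hle)
      have : x ≤ z := by
        refine le_trans ?_ h1
        rw [Nat.le_div_iff_mul_le (Nat.succ_pos N)]
        have hUx : x ≤ U i := by nlinarith
        nlinarith [Nat.mul_le_mul_left N hUx]
      omega

/-- Given coloured edges of prescribed types and sizes, we can embed them in `P` so that all
subsets of the right size are used equally often by every type, and so that every colour has
degrees between `L` and `U`, as soon as the average degrees are. -/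
theorem exists_fair_subsets {Y K α : Type*} [Fintype Y] [Finite K] [DecidableEq K]
    [DecidableEq α] (c : Y → K) (L U : K → ℕ) (P : Finset α) {J : Type*} [Finite J]
    [DecidableEq J] (τ : Y → J) (s μ : J → ℕ)
    (hτ : ∀ j, (Finset.univ.filter fun y => τ y = j).card = μ j * P.card.choose (s j))
    (hc : ∀ i, P.card * L i ≤ ∑ y with c y = i, s (τ y) ∧
      ∑ y with c y = i, s (τ y) ≤ P.card * U i) :
    ∃ f : Y → Finset α, (∀ y, f y ⊆ P ∧ (f y).card = s (τ y)) ∧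
      (∀ j S, S ⊆ P → S.card = s j →
        (Finset.univ.filter fun y => τ y = j ∧ f y = S).card = μ j) ∧
      ∀ i, ∀ a ∈ P, L i ≤ (Finset.univ.filter fun y => c y = i ∧ a ∈ f y).card ∧
        (Finset.univ.filter fun y => c y = i ∧ a ∈ f y).card ≤ U i := by
  classical
  -- The types must vary in the induction: each vertex splits every type in two.
  induction P using Finset.induction_on generalizing J with
  | empty =>
    refine ⟨fun _ => ∅, fun y => ⟨by simp, ?_⟩, fun j S hS hcard => ?_, by simp⟩
    · by_contra h
      have h1 := hτ (τ y)
      rw [Finset.card_empty,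
        Nat.choose_eq_zero_of_lt (Nat.pos_of_ne_zero fun h0 => h (by simp [h0])), mul_zero,
        Finset.card_eq_zero] at h1
      exact Finset.notMem_empty y (h1 ▸ by simp)
    · obtain rfl := Finset.subset_empty.1 hS
      have h1 := hτ j
      rw [← hcard] at h1
      simpa using h1
  | insert a P ha ih =>
    rw [Finset.card_insert_of_notMem ha] at hτ hc
    obtain ⟨Z, hZτ, hZc⟩ := exists_fair_choice τ c L U P.card s μ hτ hc
    have hspos : ∀ y ∈ Z, s (τ y) ≠ 0 := by
      intro y hy h0
      have h1 := hZτ (τ y)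
      rw [if_pos h0, Finset.card_eq_zero] at h1
      exact Finset.notMem_empty y (h1 ▸ by simp [hy])
    obtain ⟨f, hf, hfτ, hfc⟩ := ih (J := J × Bool) (fun y => (τ y, decide (y ∈ Z)))
      (fun jb => s jb.1 - if jb.2 then 1 else 0)
      -- When `s j = 0` no edge passes through `a`, yet the truncated size `0 - 1 = 0` would ask for
      -- `μ j` copies of the empty set; the multiplicity is therefore set to `0`.
      (fun jb => if jb.2 ∧ s jb.1 = 0 then 0 else μ jb.1)
      (by
        rintro ⟨j, b⟩
        have hZj : (Finset.univ.filter fun y => τ y = j ∧ y ∈ Z) =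
            Z.filter fun y => τ y = j := by
          ext y
          simp [and_comm]
        cases b
        · have h1 := Finset.card_filter_add_card_filter_not
            (s := Finset.univ.filter fun y => τ y = j) (fun y => y ∈ Z)
          rw [Finset.filter_filter, Finset.filter_filter, hZj, hZτ, hτ] at h1
          simp only [Prod.mk.injEq, decide_eq_false_iff_not, Bool.false_eq_true, false_and,
            if_false, Nat.sub_zero]
          split_ifs at h1 with h0
          · simp only [h0, Nat.choose_zero_right] at h1 ⊢
            omega
          -- Pascal's rule counts the edges of the type that avoid `a`.
          · obtain ⟨t, ht⟩ := Nat.exists_eq_succ_of_ne_zero h0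
            rw [ht] at h1 ⊢
            simp only [Nat.succ_eq_add_one, Nat.add_sub_cancel, Nat.choose_succ_succ,
              mul_add] at h1 ⊢
            omega
        · simp only [Prod.mk.injEq, decide_eq_true_eq, true_and, if_true, hZj, hZτ]
          split_ifs <;> simp)
      (by
        intro i
        have h1 : ∑ y with c y = i, s (τ y) =
            ∑ y with c y = i, (s (τ y) - if decide (y ∈ Z) then 1 else 0) +
              (Z.filter fun y => c y = i).card := by
          have h2 : (Z.filter fun y => c y = i).card =
              ∑ y with c y = i, if decide (y ∈ Z) then 1 else 0 := by
            rw [← Finset.sum_filter, Finset.sum_const, smul_eq_mul, mul_one,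
              Finset.filter_filter]
            congr 1
            ext y
            simp [and_comm]
          rw [h2, ← Finset.sum_add_distrib]
          refine Finset.sum_congr rfl fun y _ => ?_
          by_cases hy : y ∈ Z
          · have := hspos y hy
            simp only [hy, decide_true, if_true]
            omega
          · simp [hy]
        have := hZc i
        simp only
        omega)
    have hfa : ∀ y, a ∉ f y := fun y h => ha ((hf y).1 h)
    refine ⟨fun y => if y ∈ Z then insert a (f y) else f y, fun y => ?_, fun j S hS hcard => ?_,
      fun i b hb => ?_⟩
    · obtain ⟨h1, h2⟩ := hf y
      by_cases hy : y ∈ Z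
      · have := hspos y hy
        simp only [hy, if_true, decide_true] at h2 ⊢
        refine ⟨Finset.insert_subset_insert a h1, ?_⟩
        rw [Finset.card_insert_of_notMem (hfa y), h2]
        omega
      · simp only [hy, if_false, decide_false] at h2 ⊢
        exact ⟨h1.trans (Finset.subset_insert a P), by simpa using h2⟩
    · by_cases haS : a ∈ S
      · have hpos : s j ≠ 0 := by
          rw [← hcard]
          exact (Finset.card_pos.2 ⟨a, haS⟩).ne'
        have h1 := hfτ (j, true) (S.erase a) (by
          rw [← Finset.subset_insert_iff]
          exact hS) (by simp [Finset.card_erase_of_mem haS, hcard])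
        simp only [true_and, hpos, if_false] at h1
        rw [← h1]
        congr 1
        ext y
        simp only [Finset.mem_filter, Finset.mem_univ, true_and, Prod.mk.injEq,
          decide_eq_true_eq]
        by_cases hy : y ∈ Z
        · simp only [hy, if_true, and_true]
          refine and_congr_right fun _ => ⟨fun h => ?_, fun h => ?_⟩
          · rw [← h, Finset.erase_insert (hfa y)]
          · rw [h, Finset.insert_erase haS]
        · simp only [hy, if_false, and_false, false_and, iff_false, not_and]
          rintro - rfl
          exact hfa y haS
      · have h1 := hfτ (j, false) S ((Finset.subset_insert_iff_of_notMem haS).1 hS)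
          (by simpa using hcard)
        simp only [Bool.false_eq_true, false_and, if_false] at h1
        rw [← h1]
        congr 1
        ext y
        simp only [Finset.mem_filter, Finset.mem_univ, true_and, Prod.mk.injEq,
          decide_eq_false_iff_not]
        by_cases hy : y ∈ Z
        · simp only [hy, if_true, not_true, and_false, false_and, iff_false, not_and]
          rintro - rfl
          exact haS (Finset.mem_insert_self _ _)
        · simp [hy]
    · rcases Finset.mem_insert.1 hb with rfl | hbP
      · have h1 : (Finset.univ.filter fun y => c y = i ∧
            b ∈ if y ∈ Z then insert b (f y) else f y) = Z.filter fun y => c y = i := by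
          ext y
          by_cases hy : y ∈ Z <;> simp [hy, hfa y]
        rw [h1]
        exact (hZc i).1
      · have hba : b ≠ a := fun h => ha (h ▸ hbP)
        have h1 : (Finset.univ.filter fun y => c y = i ∧
            b ∈ if y ∈ Z then insert a (f y) else f y) =
            Finset.univ.filter fun y => c y = i ∧ b ∈ f y := by
          ext y
          by_cases hy : y ∈ Z <;> simp [hy, hba]
        rw [h1]
        exact hfc i b hbP

/-! ### Transversals of a partition -/

/-- Induction on the parts: once the vertices in one part are chosen, they become part of the type,
so fairness in the next parts holds for each choice separately. -/
theorem exists_fair_block_subsets {Y K V ι : Type*} {J : Type} [Fintype Y] [Finite K]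
    [DecidableEq K] [Fintype V] [DecidableEq V] [DecidableEq ι] (part : V → ι) (p : ℕ)
    (hp : ∀ x, (Finset.univ.filter fun v => part v = x).card = p)
    (c : Y → K) (L U : K → ℕ) (Q : Finset ι) [Finite J] [DecidableEq J]
    (τ : Y → J) (s : J → ι → ℕ) (μ : J → ℕ)
    (hτ : ∀ j, (Finset.univ.filter fun y => τ y = j).card =
      μ j * ∏ x ∈ Q, p.choose (s j x))
    (hc : ∀ i, ∀ x ∈ Q, p * L i ≤ ∑ y with c y = i, s (τ y) x ∧
      ∑ y with c y = i, s (τ y) x ≤ p * U i) :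
    ∃ f : Y → Finset V, (∀ y, ∀ v ∈ f y, part v ∈ Q) ∧
      (∀ y, ∀ x ∈ Q, ((f y).filter fun v => part v = x).card = s (τ y) x) ∧
      (∀ j S, (∀ v ∈ S, part v ∈ Q) →
        (∀ x ∈ Q, (S.filter fun v => part v = x).card = s j x) →
        (Finset.univ.filter fun y => τ y = j ∧ f y = S).card = μ j) ∧
      ∀ i v, part v ∈ Q → L i ≤ (Finset.univ.filter fun y => c y = i ∧ v ∈ f y).card ∧
        (Finset.univ.filter fun y => c y = i ∧ v ∈ f y).card ≤ U i := by
  classical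
  induction Q using Finset.induction_on generalizing J with
  | empty =>
    refine ⟨fun _ => ∅, by simp, by simp, fun j S hS _ => ?_, by simp⟩
    obtain rfl : S = ∅ := Finset.eq_empty_of_forall_notMem fun v hv => by simpa using hS v hv
    simpa using hτ j
  | insert x Q hx ih =>
    obtain ⟨g, hg, hgτ, hgc⟩ := exists_fair_subsets c L U
      (Finset.univ.filter fun v => part v = x) τ (fun j => s j x)
      (fun j => μ j * ∏ z ∈ Q, p.choose (s j z))
      (fun j => by rw [hτ, Finset.prod_insert hx, hp]; ring)
      (fun i => by rw [hp]; exact hc i x (Finset.mem_insert_self _ _))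
    -- The refined types live in the universe of `V`; encoding them in `Fin N` returns them to
    -- `Type`, as the induction hypothesis requires.
    obtain ⟨N, ⟨e⟩⟩ := Finite.exists_equiv_fin (J × Finset V)
    obtain ⟨f, hfQ, hf, hfτ, hfc⟩ := ih (J := Fin N) (fun y => e (τ y, g y))
      (fun t => s (e.symm t).1)
      (fun t => if (e.symm t).2 ⊆ (Finset.univ.filter fun v => part v = x) ∧
        (e.symm t).2.card = s (e.symm t).1 x then μ (e.symm t).1 else 0)
      (by
        intro t
        obtain ⟨⟨j, S⟩, rfl⟩ := e.surjective t
        simp only [EmbeddingLike.apply_eq_iff_eq, Equiv.symm_apply_apply, Prod.mk.injEq]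
        split_ifs with h
        · exact hgτ j S h.1 h.2
        · rw [zero_mul, Finset.card_eq_zero, Finset.filter_eq_empty_iff]
          rintro y - ⟨rfl, rfl⟩
          exact h (hg y))
      (fun i z hz => by
        simpa only [Equiv.symm_apply_apply] using hc i z (Finset.mem_insert_of_mem hz))
    simp only [Equiv.symm_apply_apply] at hf
    have hgx : ∀ y, ∀ v ∈ g y, part v = x := fun y v hv => by
      simpa using (hg y).1 hv
    have hfx : ∀ y, ∀ v ∈ f y, part v ≠ x := fun y v hv h => hx (h ▸ hfQ y v hv)
    have hfilter_x : ∀ y, ((g y ∪ f y).filter fun v => part v = x) = g y := by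
      intro y
      ext v
      have h1 := hgx y v
      have h2 := hfx y v
      simp only [Finset.mem_filter, Finset.mem_union]
      tauto
    have hfilter_ne : ∀ y, ((g y ∪ f y).filter fun v => part v ≠ x) = f y := by
      intro y
      ext v
      have h1 := hgx y v
      have h2 := hfx y v
      simp only [Finset.mem_filter, Finset.mem_union]
      tauto
    refine ⟨fun y => g y ∪ f y, fun y v hv => ?_, fun y z hz => ?_, fun j S hS hcard => ?_,
      fun i v hv => ?_⟩
    · rcases Finset.mem_union.1 hv with h | h
      · exact Finset.mem_insert.2 (Or.inl (hgx y v h))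
      · exact Finset.mem_insert_of_mem (hfQ y v h)
    · rcases Finset.mem_insert.1 hz with rfl | hzQ
      · rw [hfilter_x]
        exact (hg y).2
      · rw [← hf y z hzQ]
        congr 1
        ext v
        simp only [Finset.mem_filter, Finset.mem_union, and_congr_left_iff, or_iff_right_iff_imp]
        rintro rfl h
        exact absurd (hgx y v h ▸ hzQ) hx
    · have h1 := hfτ (e (j, S.filter fun v => part v = x)) (S.filter fun v => part v ≠ x)
        (fun v hv => by
          obtain ⟨hvS, hvx⟩ := Finset.mem_filter.1 hv
          exact (Finset.mem_insert.1 (hS v hvS)).resolve_left hvx)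
        (fun z hz => by
          rw [Equiv.symm_apply_apply, ← hcard z (Finset.mem_insert_of_mem hz), Finset.filter_filter]
          congr 1
          ext v
          simp only [Finset.mem_filter, and_congr_right_iff, and_iff_right_iff_imp]
          rintro - rfl h
          exact hx (h ▸ hz))
      simp only [EmbeddingLike.apply_eq_iff_eq, Equiv.symm_apply_apply] at h1
      rw [if_pos ⟨Finset.filter_subset_filter _ (Finset.subset_univ S),
        hcard x (Finset.mem_insert_self _ _)⟩] at h1
      rw [← h1]
      congr 1
      ext y
      simp only [Finset.mem_filter, Finset.mem_univ, true_and, Prod.mk.injEq, and_assoc]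
      refine and_congr_right fun _ => ⟨?_, fun h => ?_⟩
      · rintro rfl
        exact ⟨(hfilter_x y).symm, (hfilter_ne y).symm⟩
      · rw [h.1, h.2, Finset.filter_union_filter_not_eq]
    · by_cases hvx : part v = x
      · have h1 : ∀ y, v ∈ g y ∪ f y ↔ v ∈ g y := fun y => by
          rw [Finset.mem_union, or_iff_left fun h => hfx y v h hvx]
        simp only [h1]
        exact hgc i v (by simpa using hvx)
      · have h1 : ∀ y, v ∈ g y ∪ f y ↔ v ∈ f y := fun y => by
          rw [Finset.mem_union, or_iff_right fun h => hvx (hgx y v h)]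
        simp only [h1]
        exact hfc i v ((Finset.mem_insert.1 hv).resolve_left hvx)

/-- Coloured edges of prescribed types can be realised as transversals of a partition into `n`
parts of size `p`, all transversals of the right size being used `Λ j` times by the type `j`, with
the degrees of every colour between `L` and `U`, as soon as the average degrees are. -/
theorem exists_fair_transversals {Y K V : Type*} {ι J : Type} [Fintype Y] [Finite K] [DecidableEq K]
    [Fintype V] [DecidableEq V] [Fintype ι] [DecidableEq ι] [Finite J] [DecidableEq J]
    (part : V → ι) (n p : ℕ) (hn : Fintype.card ι = n)
    (hp : ∀ x, (Finset.univ.filter fun v => part v = x).card = p)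
    (c : Y → K) (L U : K → ℕ) (τ : Y → J) (H Λ : J → ℕ)
    (hτ : ∀ j, (Finset.univ.filter fun y => τ y = j).card = Λ j * n.choose (H j) * p ^ H j)
    (hc : ∀ i, n * p * L i ≤ ∑ y with c y = i, H (τ y) ∧
      ∑ y with c y = i, H (τ y) ≤ n * p * U i) :
    ∃ f : Y → Finset V, (∀ y, (f y).card = H (τ y) ∧ Set.InjOn part (f y : Set V)) ∧
      (∀ (j : J) (S : Finset V), S.card = H j → Set.InjOn part (S : Set V) →
        (Finset.univ.filter fun y => τ y = j ∧ f y = S).card = Λ j) ∧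
      ∀ i v, L i ≤ (Finset.univ.filter fun y => c y = i ∧ v ∈ f y).card ∧
        (Finset.univ.filter fun y => c y = i ∧ v ∈ f y).card ≤ U i := by
  classical
  -- First the set of parts met by each edge: a part counts as one point of degree between `p * L i`
  -- and `p * U i`, and each set of `H j` parts carries `p ^ H j` transversals.
  obtain ⟨g, hg, hgτ, hgc⟩ := exists_fair_subsets c (fun i => p * L i) (fun i => p * U i)
    (Finset.univ : Finset ι) τ H (fun j => Λ j * p ^ H j)
    (fun j => by rw [hτ, Finset.card_univ, hn]; ring)
    (fun i => by rw [Finset.card_univ, hn, ← mul_assoc, ← mul_assoc]; exact hc i)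
  obtain ⟨f, -, hf, hfτ, hfc⟩ := exists_fair_block_subsets part p hp c L U Finset.univ
    (J := J × Finset ι) (fun y => (τ y, g y)) (fun jS x => if x ∈ jS.2 then 1 else 0)
    (fun jS => if jS.2.card = H jS.1 then Λ jS.1 else 0)
    (by
      rintro ⟨j, S⟩
      have hprod : ∏ x : ι, p.choose (if x ∈ S then 1 else 0) = p ^ S.card := by
        have : ∀ x, p.choose (if x ∈ S then 1 else 0) = if x ∈ S then p else 1 := by
          intro x
          split_ifs <;> simp
        simp [this]
      simp only [Prod.mk.injEq, hprod]
      split_ifs with h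
      · rw [hgτ j S (Finset.subset_univ S) h, h]
      · rw [zero_mul, Finset.card_eq_zero, Finset.filter_eq_empty_iff]
        rintro y - ⟨rfl, rfl⟩
        exact h (hg y).2)
    (fun i x _ => by
      have := hgc i x (Finset.mem_univ x)
      rw [← Finset.filter_filter, Finset.card_filter (fun y => x ∈ g y)] at this
      exact this)
  refine ⟨f, fun y => ⟨?_, ?_⟩, fun j S hS hinj => ?_, fun i v => hfc i v (Finset.mem_univ _)⟩
  · rw [Finset.card_eq_sum_card_fiberwise (f := part) (t := Finset.univ) (by simp),
      Finset.sum_congr rfl (hf y), ← (hg y).2]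
    simp
  · intro u hu v hv huv
    have h1 : ((f y).filter fun w => part w = part v).card ≤ 1 := by
      rw [hf y _ (Finset.mem_univ _)]
      simp only
      split_ifs <;> omega
    exact Finset.card_le_one.1 h1 u (by simpa [huv] using hu) v (by simpa using hv)
  · have h1 := hfτ (j, S.image part) S (fun _ _ => Finset.mem_univ _) (fun x _ => by
      simp only [Finset.mem_image]
      split_ifs with h
      · obtain ⟨v, hv, rfl⟩ := h
        rw [Finset.card_eq_one]
        refine ⟨v, ?_⟩
        ext u
        simp only [Finset.mem_filter, Finset.mem_singleton]
        exact ⟨fun hu => hinj hu.1 hv hu.2, fun hu => by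
          subst hu
          exact ⟨hv, rfl⟩⟩
      · rw [Finset.card_eq_zero, Finset.filter_eq_empty_iff]
        exact fun v hv hx => h ⟨v, hv, hx⟩)
    simp only at h1
    rw [if_pos (by rw [Finset.card_image_of_injOn hinj, hS])] at h1
    rw [← h1]
    congr 1
    ext y
    simp only [Finset.mem_filter, Finset.mem_univ, true_and, Prod.mk.injEq, and_assoc]
    refine and_congr_right fun _ => ⟨?_, fun h => h.2⟩
    rintro rfl
    refine ⟨?_, rfl⟩
    -- The set of parts is determined by the edge: `g y` is the image of `f y`.
    ext x
    have h2 := hf y x (Finset.mem_univ x)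
    simp only at h2
    have h3 : x ∈ (f y).image part ↔ 0 < ((f y).filter fun v => part v = x).card := by
      simp [Finset.card_pos, Finset.Nonempty]
    rw [h3, h2]
    by_cases h4 : x ∈ g y <;> simp [h4]

/-- The number of transversals of size `h` of a partition into `n` parts of size `p`. -/
theorem card_transversals {V : Type*} {ι : Type} [Fintype V] [DecidableEq V] [Fintype ι]
    [DecidableEq ι] (part : V → ι) (n p : ℕ) (hn : Fintype.card ι = n)
    (hp : ∀ x, (Finset.univ.filter fun v => part v = x).card = p) (h : ℕ)
    [DecidablePred fun S : Finset V => S.card = h ∧ Set.InjOn part (S : Set V)] :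
    (Finset.univ.filter fun S : Finset V => S.card = h ∧ Set.InjOn part (S : Set V)).card =
      n.choose h * p ^ h := by
  -- With one colour, one type, multiplicity `1` and a crude upper degree bound, the edges enumerate
  -- the transversals without repetition.
  obtain ⟨f, hf, hfS, -⟩ := exists_fair_transversals (Y := Fin (n.choose h * p ^ h)) (K := Unit)
    (J := Unit) part n p hn hp (fun _ => ()) (fun _ => 0) (fun _ => n.choose h * p ^ h * h)
    (fun _ => ()) (fun _ => h) (fun _ => 1) (by simp) (fun _ => ⟨by simp, by
      rcases Nat.eq_zero_or_pos (n * p) with h0 | hpos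
      · rcases Nat.eq_zero_or_pos h with rfl | hh
        · simp
        · rcases Nat.mul_eq_zero.1 h0 with h1 | h1
          · simp [h1, Nat.choose_eq_zero_of_lt hh]
          · simp [h1, hh.ne']
      · simpa using Nat.le_mul_of_pos_left _ hpos⟩)
  have h1 : Finset.card (Finset.univ : Finset (Fin (n.choose h * p ^ h))) =
      ∑ S ∈ Finset.univ.filter fun S : Finset V => S.card = h ∧ Set.InjOn part (S : Set V),
        (Finset.univ.filter fun y => f y = S).card :=
    Finset.card_eq_sum_card_fiberwise fun y _ => by simpa using hf y
  rw [Finset.card_univ, Fintype.card_fin] at h1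
  rw [h1, Finset.card_eq_sum_ones]
  refine Finset.sum_congr rfl fun S hS => ?_
  obtain ⟨h2, h3⟩ := (Finset.mem_filter.1 hS).2
  simpa using (hfS () S h2 h3).symm

/-! ### Hypergraphs as families of vertex sets, factorizations as colourings -/

namespace HingeHypergraph

variable {V E T : Type*}

theorem mem_edgesJoining_val [DecidableEq V] (G : HingeHypergraph V E T) (U : Finset V) (e : E) :
    e ∈ G.edgesJoining U.val ↔ ∀ v, (G.hinges v e).ncard = if v ∈ U then 1 else 0 := by
  unfold edgesJoining
  simp only [Set.mem_ofPred_eq]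
  refine forall_congr' fun v => ?_
  by_cases hv : v ∈ U
  · have h (d : DecidableEq V) : @Multiset.count V d v U.val = 1 :=
      Multiset.count_eq_one_of_mem U.nodup hv
    rw [h, if_pos hv]
  · have h (d : DecidableEq V) : @Multiset.count V d v U.val = 0 :=
      Multiset.count_eq_zero_of_notMem hv
    rw [h, if_neg hv]

theorem edgesJoining_val_eq (G : HingeHypergraph V E T) (u : E → Finset V)
    (hu : ∀ e, e ∈ G.edgesJoining (u e).val) (U : Finset V) :
    G.edgesJoining U.val = {e | u e = U} := by
  classical
  ext e
  refine ⟨fun h => ?_, fun h => h ▸ hu e⟩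
  have h1 := (G.mem_edgesJoining_val _ e).1 h
  have h2 := (G.mem_edgesJoining_val _ e).1 (hu e)
  change u e = U
  ext v
  have h3 := (h1 v).symm.trans (h2 v)
  by_cases ha : v ∈ U <;> by_cases hb : v ∈ u e <;> simp_all

/-- An edge has at most one hinge at each vertex, so counting hinges at `v` amounts to counting
edges. -/
theorem degree_spanningSub_eq [Finite T] (G : HingeHypergraph V E T) (u : E → Finset V)
    (hu : ∀ e, e ∈ G.edgesJoining (u e).val) (F : Set E) (v : V) :
    (G.spanningSub F).degree v = {e | e ∈ F ∧ v ∈ u e}.ncard := by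
  classical
  have hh : ∀ e, (G.hinges v e).ncard = if v ∈ u e then 1 else 0 := fun e =>
    (G.mem_edgesJoining_val _ e).1 (hu e) v
  unfold degree
  refine Set.ncard_congr (fun t _ => G.φ t.1) ?_ ?_ ?_
  · rintro ⟨t, ht⟩ hv
    refine ⟨ht, ?_⟩
    by_contra hvu
    have h1 := hh (G.φ t)
    rw [if_neg hvu, Set.ncard_eq_zero] at h1
    exact Set.notMem_empty t (h1 ▸ (⟨hv, rfl⟩ : t ∈ G.hinges v (G.φ t)))
  · rintro ⟨t, ht⟩ ⟨t', ht'⟩ hv hv' heq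
    have h1 : (G.hinges v (G.φ t)).ncard ≤ 1 := by
      rw [hh]
      split_ifs <;> omega
    exact Subtype.ext ((Set.ncard_le_one).1 h1 t ⟨hv, rfl⟩ t' ⟨hv', heq.symm⟩)
  · rintro e ⟨heF, hve⟩
    have h1 := hh e
    rw [if_pos hve, Set.ncard_eq_one] at h1
    obtain ⟨t, ht⟩ := h1
    have h2 : t ∈ G.hinges v e := ht ▸ rfl
    exact ⟨⟨t, show G.φ t ∈ F from h2.2.symm ▸ heF⟩, h2.1, h2.2⟩

theorem isFactorizable_iff_exists_coloring [Fintype E] [Finite T] [DecidableEq V]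
    (G : HingeHypergraph V E T) (u : E → Finset V) (hu : ∀ e, e ∈ G.edgesJoining (u e).val)
    {k : ℕ} (Q R : Fin k → ℤ) :
    G.IsFactorizable Q R ↔ ∃ c : E → Fin k, ∀ i v,
      Q i ≤ (Finset.univ.filter fun e => c e = i ∧ v ∈ u e).card ∧
        ((Finset.univ.filter fun e => c e = i ∧ v ∈ u e).card : ℤ) ≤ R i := by
  have hcard : ∀ (c : E → Fin k) i v, (G.spanningSub {e | c e = i}).degree v =
      (Finset.univ.filter fun e => c e = i ∧ v ∈ u e).card := by
    intro c i v
    rw [G.degree_spanningSub_eq u hu, ← Set.ncard_coe_finset]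
    congr 1
    ext e
    simp
  constructor
  · rintro ⟨F, hdisj, hcover, hF⟩
    have hex : ∀ e, ∃ i, e ∈ F i := fun e => by
      rw [← Set.mem_iUnion, hcover]
      trivial
    choose c hc using hex
    have hFc : ∀ i, F i = {e | c e = i} := by
      intro i
      ext e
      refine ⟨fun he => ?_, fun he => (show c e = i from he) ▸ hc e⟩
      by_contra hne
      exact Set.disjoint_left.1 (hdisj hne) (hc e) he
    refine ⟨c, fun i v => ?_⟩
    rw [← hcard, ← hFc]
    exact hF i v
  · rintro ⟨c, hc⟩
    refine ⟨fun i => {e | c e = i}, fun i j hij => ?_, ?_, fun i v => ?_⟩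
    · exact Set.disjoint_left.2 fun e (he : c e = i) (he' : c e = j) => hij (he.symm.trans he')
    · ext e
      simp
    · rw [hcard]
      exact hc i v

end HingeHypergraph

/-! ### Colourings, matrices and the main theorem -/

theorem exists_equiv_of_card_fiber_eq {Y E X : Type*} [Fintype Y] [Fintype E] [DecidableEq X]
    (f : Y → X) (u : E → X)
    (h : ∀ x, (Finset.univ.filter fun y => f y = x).card =
      (Finset.univ.filter fun e => u e = x).card) :
    ∃ σ : Y ≃ E, ∀ y, u (σ y) = f y := by
  have hσ : ∀ x, Nonempty ({y // f y = x} ≃ {e // u e = x}) := fun x => by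
    rw [← Fintype.card_eq, Fintype.card_subtype, Fintype.card_subtype, h]
  exact ⟨Equiv.ofFiberEquiv fun x => (hσ x).some, fun y => Equiv.ofFiberEquiv_map _ y⟩

/-- Colour classes with prescribed numbers `A i j` of edges of size `H j` and almost constant
degrees exist in a complete multipartite hypergraph iff the average degrees allow it. -/
theorem exists_coloring_iff_exists_matrix {V E : Type*} [Fintype V] [Fintype E] [DecidableEq V]
    (n p k m : ℕ) (L U : Fin k → ℕ) (Λ H : Fin m → ℕ)
    (hH : Function.Injective H) (part : V → Fin n)
    (hp : ∀ x, (Finset.univ.filter fun v => part v = x).card = p) (u : E → Finset V)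
    (τ : E → Fin m) (hu : ∀ e, (u e).card = H (τ e) ∧ Set.InjOn part (u e : Set V))
    (hΛ : ∀ (j : Fin m) (S : Finset V), S.card = H j → Set.InjOn part (S : Set V) →
      (Finset.univ.filter fun e => u e = S).card = Λ j) :
    (∃ c : E → Fin k, ∀ i v, L i ≤ (Finset.univ.filter fun e => c e = i ∧ v ∈ u e).card ∧
      (Finset.univ.filter fun e => c e = i ∧ v ∈ u e).card ≤ U i) ↔
    ∃ A : Matrix (Fin k) (Fin m) ℕ,
      (∀ i, n * p * L i ≤ A.mulVec H i ∧ A.mulVec H i ≤ n * p * U i) ∧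
      ∀ j, ∑ i, A i j = Λ j * n.choose (H j) * p ^ H j := by
  classical
  constructor
  · rintro ⟨c, hc⟩
    refine ⟨fun i j => (Finset.univ.filter fun e => c e = i ∧ τ e = j).card, fun i => ?_,
      fun j => ?_⟩
    · have hV : Fintype.card V = n * p := by
        rw [← Finset.card_univ, Finset.card_eq_sum_card_fiberwise (f := part) (t := Finset.univ)
          (by simp)]
        simp [hp]
      have hsum : Matrix.mulVec
          (fun i j => (Finset.univ.filter fun e => c e = i ∧ τ e = j).card) H i =
          ∑ v, (Finset.univ.filter fun e => c e = i ∧ v ∈ u e).card := by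
        calc _ = ∑ j, ∑ e with c e = i ∧ τ e = j, H (τ e) := by
              unfold Matrix.mulVec dotProduct
              refine Finset.sum_congr rfl fun j _ => ?_
              rw [Finset.sum_congr rfl (g := fun _ => H j) (fun e he => by
                rw [(Finset.mem_filter.1 he).2.2]), Finset.sum_const, smul_eq_mul]
          _ = ∑ e with c e = i, H (τ e) := by
              rw [← Finset.sum_fiberwise _ τ fun e => H (τ e)]
              simp only [Finset.filter_filter]
          _ = ∑ e with c e = i, ∑ v, if v ∈ u e then 1 else 0 := by
              refine Finset.sum_congr rfl fun e _ => ?_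
              rw [← (hu e).1]
              simp
          _ = _ := by
              rw [Finset.sum_comm]
              refine Finset.sum_congr rfl fun v _ => ?_
              rw [← Finset.card_filter, Finset.filter_filter]
      rw [hsum, ← hV, ← smul_eq_mul, ← smul_eq_mul, ← Finset.card_univ]
      exact ⟨Finset.card_nsmul_le_sum _ _ _ fun v _ => (hc i v).1,
        Finset.sum_le_card_nsmul _ _ _ fun v _ => (hc i v).2⟩
    · have h1 : ∑ i, (Finset.univ.filter fun e => c e = i ∧ τ e = j).card =
          (Finset.univ.filter fun e => τ e = j).card := by
        rw [Finset.card_eq_sum_card_fiberwise (s := Finset.univ.filter fun e => τ e = j) (f := c)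
          (t := Finset.univ) (by simp)]
        simp only [Finset.filter_filter, and_comm]
      -- The edges of type `j` are grouped by vertex set: `Λ j` for each transversal of size `H j`.
      rw [h1, Finset.card_eq_sum_card_fiberwise (f := u)
        (t := Finset.univ.filter fun S : Finset V =>
          S.card = H j ∧ Set.InjOn part (S : Set V)) (fun e he => by
            obtain rfl : τ e = j := by simpa using he
            simpa using hu e), mul_assoc, ← card_transversals part n p (Fintype.card_fin n) hp,
        mul_comm, ← smul_eq_mul, ← Finset.sum_const]
      refine Finset.sum_congr rfl fun S hS => ?_
      obtain ⟨h2, h3⟩ := (Finset.mem_filter.1 hS).2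
      rw [← hΛ j S h2 h3, Finset.filter_filter]
      congr 1
      ext e
      simp only [Finset.mem_filter, Finset.mem_univ, true_and, and_iff_right_iff_imp]
      rintro rfl
      exact hH ((hu e).1.symm.trans h2)
  · rintro ⟨A, hA, hA'⟩
    obtain ⟨B, hB⟩ : ∃ B : Fin k → Fin m → ℕ, ∀ i j, A i j = B i j := ⟨A, fun _ _ => rfl⟩
    obtain ⟨f, hf, hfS, hfc⟩ := exists_fair_transversals
      (Y := Σ i : Fin k, Σ j : Fin m, Fin (B i j)) part n p (Fintype.card_fin n) hp
      (fun y => y.1) L U (fun y => y.2.1) H Λ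
      (fun j => by
        rw [← hA', Finset.card_filter, Fintype.sum_sigma]
        refine Finset.sum_congr rfl fun i _ => ?_
        rw [Fintype.sum_sigma, hB]
        rw [Finset.sum_eq_single j] <;> simp +contextual)
      (fun i => by
        have h1 : ∑ y : (Σ i : Fin k, Σ j : Fin m, Fin (B i j)) with y.1 = i, H y.2.1 =
            A.mulVec H i := by
          rw [Finset.sum_filter, Fintype.sum_sigma, Finset.sum_eq_single i]
          · rw [Fintype.sum_sigma]
            simp [Matrix.mulVec, dotProduct, hB]
          · intro b _ hb
            simp [hb]
          · simp
        rw [h1]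
        exact hA i)
    -- The abstract edges and those of the hypergraph occur equally often on every vertex set, so a
    -- bijection carries the colours over. Injectivity of `H` makes the size determine the type.
    obtain ⟨σ, hσ⟩ := exists_equiv_of_card_fiber_eq f u (fun S => by
      by_cases hS : ∃ j, S.card = H j ∧ Set.InjOn part (S : Set V)
      · obtain ⟨j, h1, h2⟩ := hS
        rw [hΛ j S h1 h2, ← hfS j S h1 h2]
        congr 1
        ext y
        simp only [Finset.mem_filter, Finset.mem_univ, true_and, iff_and_self]
        rintro rfl
        exact hH ((hf y).1.symm.trans h1)
      · rw [Finset.filter_false_of_mem, Finset.filter_false_of_mem]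
        · simp
        · rintro e - rfl
          exact hS ⟨_, hu e⟩
        · rintro y - rfl
          exact hS ⟨_, hf y⟩)
    refine ⟨fun e => (σ.symm e).1, fun i v => ?_⟩
    have h1 : (Finset.univ.filter fun e => (σ.symm e).1 = i ∧ v ∈ u e).card =
        (Finset.univ.filter fun y => y.1 = i ∧ v ∈ f y).card := by
      symm
      refine Finset.card_equiv σ fun y => ?_
      simp [hσ]
    rw [h1]
    exact hfc i v

/-- The row bounds are added up and divided by `n * p`; the identity `h * n.choose h = n * (n -
1).choose (h - 1)` turns the total into the degree of a vertex. -/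
theorem average_degree_bounds {n p k m : ℕ} (hn : 1 ≤ n) (hp : 1 ≤ p) (R : Fin k → ℕ)
    (Λ H : Fin m → ℕ) (hH : ∀ j, 1 ≤ H j) (A : Matrix (Fin k) (Fin m) ℕ)
    (hA : ∀ i, (n : ℤ) * (p : ℤ) * ((R i : ℤ) - 1) ≤ ((A.mulVec H i : ℕ) : ℤ) ∧
      ((A.mulVec H i : ℕ) : ℤ) ≤ (n : ℤ) * (p : ℤ) * (R i : ℤ))
    (hA' : ∀ j, ∑ i, A i j = Λ j * n.choose (H j) * p ^ H j) :
    (∑ i, (R i : ℤ)) - (k : ℤ)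
        ≤ ∑ j, (Λ j : ℤ) * ((n - 1).choose (H j - 1) : ℤ) * (p : ℤ) ^ (H j - 1) ∧
      ∑ j, (Λ j : ℤ) * ((n - 1).choose (H j - 1) : ℤ) * (p : ℤ) ^ (H j - 1)
        ≤ ∑ i, (R i : ℤ) := by
  have hsum : ∑ i, ((A.mulVec H i : ℕ) : ℤ) = (n : ℤ) * p *
      ∑ j, (Λ j : ℤ) * ((n - 1).choose (H j - 1) : ℤ) * (p : ℤ) ^ (H j - 1) := by
    rw [← Nat.cast_sum]
    simp only [Matrix.mulVec, dotProduct]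
    rw [Finset.sum_comm]
    simp only [← Finset.sum_mul, hA']
    push_cast
    rw [Finset.mul_sum]
    refine Finset.sum_congr rfl fun j _ => ?_
    obtain ⟨t, ht⟩ := Nat.exists_eq_add_of_le (hH j)
    obtain ⟨N, rfl⟩ := Nat.exists_eq_add_of_le hn
    rw [ht]
    have h1 := Nat.add_one_mul_choose_eq N t
    have h2 : ((N : ℤ) + 1) * (N.choose t : ℤ) =
        ((1 + N).choose (1 + t) : ℤ) * ((t : ℤ) + 1) := by
      rw [add_comm 1 N, add_comm 1 t]
      exact_mod_cast h1
    simp only [Nat.add_sub_cancel_left]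
    push_cast
    rw [pow_add]
    linear_combination (-(Λ j : ℤ) * p * p ^ t) * h2
  have hpos : (0 : ℤ) < (n : ℤ) * p := by positivity
  constructor
  · refine le_of_mul_le_mul_left ?_ hpos
    rw [← hsum]
    refine le_trans (le_of_eq ?_) (Finset.sum_le_sum fun i _ => (hA i).1)
    rw [← Finset.mul_sum, Finset.sum_sub_distrib]
    simp
  · refine le_of_mul_le_mul_left ?_ hpos
    rw [← hsum, Finset.mul_sum]
    exact Finset.sum_le_sum fun i _ => (hA i).2

theorem theorem6p6 {V E T : Type*} [Finite V] [Finite E] [Finite T]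
    (n p k m : ℕ) (hn : 1 ≤ n) (hp : 1 ≤ p)
    (R : Fin k → ℕ) (hR : ∀ i, 1 ≤ R i)
    (Λ : Fin m → ℕ) (hΛ : ∀ j, 1 ≤ Λ j)
    (H : Fin m → ℕ) (hH : ∀ j, 2 ≤ H j ∧ H j ≤ n) (hHinj : Function.Injective H)
    (G : HingeHypergraph V E T) (hG : G.IsCompleteMultipartite n p Λ H) :
    G.IsAlmostFactorizable (fun i => (R i : ℤ)) ↔
      (((∑ i, (R i : ℤ)) - (k : ℤ)
            ≤ ∑ j, (Λ j : ℤ) * ((n - 1).choose (H j - 1) : ℤ) * (p : ℤ) ^ (H j - 1) ∧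
          ∑ j, (Λ j : ℤ) * ((n - 1).choose (H j - 1) : ℤ) * (p : ℤ) ^ (H j - 1)
            ≤ ∑ i, (R i : ℤ)) ∧
        ∃ A : Matrix (Fin k) (Fin m) ℕ,
          (∀ i, (n : ℤ) * (p : ℤ) * ((R i : ℤ) - 1) ≤ ((A.mulVec H i : ℕ) : ℤ) ∧
            ((A.mulVec H i : ℕ) : ℤ) ≤ (n : ℤ) * (p : ℤ) * (R i : ℤ)) ∧
          ∀ j, ∑ i, A i j = Λ j * n.choose (H j) * p ^ H j) := by
 
  classical
  have := Fintype.ofFinite V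
  have := Fintype.ofFinite E
  obtain ⟨part, hpart, hmult, hedge⟩ := hG
  choose τ u hcard hinj hu using hedge
  have hiff : G.IsAlmostFactorizable (fun i => (R i : ℤ)) ↔
      ∃ A : Matrix (Fin k) (Fin m) ℕ,
        (∀ i, (n : ℤ) * (p : ℤ) * ((R i : ℤ) - 1) ≤ ((A.mulVec H i : ℕ) : ℤ) ∧
          ((A.mulVec H i : ℕ) : ℤ) ≤ (n : ℤ) * (p : ℤ) * (R i : ℤ)) ∧
        ∀ j, ∑ i, A i j = Λ j * n.choose (H j) * p ^ H j := by
    have hmain := exists_coloring_iff_exists_matrix n p k m (fun i => R i - 1) R Λ H hHinj part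
      (fun x => by
        rw [← hpart x, ← Set.ncard_coe_finset]
        simp) u τ (fun e => ⟨hcard e, hinj e⟩)
      (fun j S h1 h2 => by
        rw [← hmult j S h1 h2, HingeHypergraph.multiplicity, G.edgesJoining_val_eq u hu,
          ← Set.ncard_coe_finset]
        simp)
    -- Positivity of `R i` makes the truncated subtraction genuine.
    have hsub : ∀ i, ((R i - 1 : ℕ) : ℤ) = (R i : ℤ) - 1 := fun i => by
      have := hR i
      omega
    rw [HingeHypergraph.IsAlmostFactorizable, G.isFactorizable_iff_exists_coloring u hu]
    simp only [← hsub]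
    exact_mod_cast hmain
  rw [hiff]
  constructor
  · rintro ⟨A, hA, hA'⟩
    exact ⟨average_degree_bounds hn hp R Λ H (fun j => (by decide : 1 ≤ 2).trans (hH j).1) A hA hA',
      A, hA, hA'⟩
  · exact fun h => h.2
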